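/- **Proposition 3.3.** Let $\Lambda$ be an Artin algebra (an algebra over a commutative Artinian ring $R$, finitely generated as an $R$-module), let $\operatorname{mod}\Lambda$ be the category of finitely generated left $\Lambda$-modules, and suppose that $\operatorname{gl.dim}\Lambda=n$ with $n\ge 2$. Suppose that $\Lambda$ admits a maximal $(n-1)$-orthogonal subcategory of $\operatorname{mod}\Lambda$, that is, a full subcategory $\mathscr C\subseteq\operatorname{mod}\Lambda$ which is functorially finite in $\operatorname{mod}\Lambda$ (every $X\in\operatorname{mod}\Lambda$ has a left and a right $\mathscr C$-approximation) and satisfies $$\mathscr C=\{X\in\operatorname{mod}\Lambda \mid \operatorname{Ext}^i_\Lambda(X,C)=0\ \text{for all } C\in\mathscr C,\ 1\le i\le n-1\}$$ $$\phantom{\mathscr C}=\{X\in\operatorname{mod}\Lambda \mid \operatorname{Ext}^i_\Lambda(C,X)=0\ \text{for all } C\in\mathscr C,\ 1\le i\le n-1\}.$$ Let $0\to\Lambda\to I^0(\Lambda)\to I^1(\Lambda)\to\cdots$ and $0\to\Lambda^{op}\to I^0(\Lambda^{op})\to I^1(\Lambda^{op})\to\cdots$ be minimal injective resolutions of the regular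 left modules over $\Lambda$ and over the opposite algebra $\Lambda^{op}$. Then the following statements are equivalent. 1. $\Lambda$ is an $(n-1)$-Auslander algebra, i.e. $\operatorname{gl.dim}\Lambda\le n$ and $I^0(\Lambda),I^1(\Lambda),\dots,I^{n-1}(\Lambda)$ are projective. 2. $\operatorname{pd}_\Lambda\bigoplus_{i=1}^{n-1}I^i(\Lambda)\le n-1$. 3. $\operatorname{pd}_{\Lambda^{op}}\bigoplus_{i=1}^{n-1}I^i(\Lambda^{op})\le n-1$. -/

import Mathlib

open CategoryTheory

universe u

namespace HigherAuslander

noncomputable section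

/-! ### Injective envelopes and minimal injective resolutions -/

/-- `f : M ⟶ E` is an injective envelope: `E` is injective, `f` is a monomorphism and its image is
essential, i.e. it meets every nonzero submodule of `E` nontrivially. -/
structure IsInjectiveEnvelope {Λ : Type u} [Ring Λ] {M E : ModuleCat.{u} Λ} (f : M ⟶ E) :
    Prop where
  injective : Injective E
  mono : Mono f
  essential : ∀ N : Submodule Λ E, N ⊓ LinearMap.range f.hom = ⊥ → N = ⊥

/-- Inside an injective module every submodule is contained, as an essential submodule,
in a submodule that is injective. -/
theorem exists_injective_essential_extension {Λ : Type u} [Ring Λ] {E : Type u} [AddCommGroup E]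
    [Module Λ E] [hE : Module.Injective Λ E] (A : Submodule Λ E) :
    ∃ N : Submodule Λ E, A ≤ N ∧ (∀ x ∈ N, x ≠ 0 → ∃ r : Λ, r • x ≠ 0 ∧ r • x ∈ A) ∧
      Module.Injective Λ N := by
  -- a maximal essential extension `N` of `A` inside `E`
  obtain ⟨N, hAN, hN⟩ := zorn_le_nonempty₀
    {N : Submodule Λ E | A ≤ N ∧ ∀ x ∈ N, x ≠ 0 → ∃ r : Λ, r • x ≠ 0 ∧ r • x ∈ A}
    (fun c hc hchain y hy => ⟨sSup c, ⟨(hc hy).1.trans (le_sSup hy), fun x hx hx0 => by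
      obtain ⟨N, hNc, hxN⟩ := (Submodule.mem_sSup_of_directed ⟨y, hy⟩ hchain.directedOn).1 hx
      exact (hc hNc).2 x hxN hx0⟩, fun z hz => le_sSup hz⟩)
    A ⟨le_rfl, fun x hx hx0 => ⟨1, by simpa using hx0, by simpa using hx⟩⟩
  -- a maximal submodule `P` with `P ∩ N = 0`
  obtain ⟨P, -, hP⟩ := zorn_le_nonempty₀
    {P : Submodule Λ E | ∀ x ∈ P, x ∈ N → x = 0}
    (fun c hc hchain y hy => ⟨sSup c, fun x hx hxN => by
      obtain ⟨Q, hQc, hxQ⟩ := (Submodule.mem_sSup_of_directed ⟨y, hy⟩ hchain.directedOn).1 hx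
      exact hc hQc x hxQ hxN, fun z hz => le_sSup hz⟩)
    ⊥ (fun x hx _ => by simpa using hx)
  let j : N →ₗ[Λ] E ⧸ P := P.mkQ ∘ₗ N.subtype
  have hj : Function.Injective j := by
    rw [injective_iff_map_eq_zero]
    intro x hx
    exact Subtype.ext (hP.1 x ((Submodule.Quotient.mk_eq_zero P).1 hx) x.2)
  have hess : ∀ y : E ⧸ P, y ≠ 0 → ∃ (r : Λ) (n : N), n ≠ 0 ∧ r • y = j n := by
    intro y hy
    obtain ⟨e, rfl⟩ := P.mkQ_surjective y
    have he : e ∉ P := fun h => hy ((Submodule.Quotient.mk_eq_zero P).2 h)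
    by_contra! hcon
    apply he
    have : (P ⊔ Submodule.span Λ {e}) ≤ P := hP.2 (fun x hx hxN => by
      obtain ⟨p, hp, z, hz, rfl⟩ := Submodule.mem_sup.1 hx
      obtain ⟨r, rfl⟩ := Submodule.mem_span_singleton.1 hz
      by_contra hne
      refine hcon r ⟨_, hxN⟩ (fun h => hne (congrArg Subtype.val h)) ?_
      have : P.mkQ p = 0 := (Submodule.Quotient.mk_eq_zero P).2 hp
      simp only [j, LinearMap.comp_apply, Submodule.subtype_apply, map_add, map_smul, this,
        zero_add]) le_sup_left
    exact this (Submodule.mem_sup_right (Submodule.mem_span_singleton_self e))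
  obtain ⟨g, hg⟩ := hE.out j hj N.subtype
  have hgN : LinearMap.range g ≤ N := by
    refine hN.2 ⟨hAN.trans ?_, ?_⟩ ?_
    · intro x hx; exact ⟨j ⟨x, hx⟩, hg ⟨x, hx⟩⟩
    · rintro _ ⟨y, rfl⟩ hy
      obtain ⟨r, n, hn, hrn⟩ := hess y (fun h => hy (by simp [h]))
      have h1 : r • g y = n := by rw [← map_smul, hrn, hg]; rfl
      obtain ⟨s, hs0, hsA⟩ := hN.1.2 n n.2 (fun h => hn (Subtype.ext h))
      exact ⟨s * r, by rwa [mul_smul, h1], by rwa [mul_smul, h1]⟩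
    · intro x hx; exact ⟨j ⟨x, hx⟩, hg ⟨x, hx⟩⟩
  refine ⟨N, hAN, hN.1.2, ⟨fun X Y _ _ _ _ f hf k => ?_⟩⟩
  obtain ⟨h, hh⟩ := hE.out f hf (N.subtype ∘ₗ k)
  refine ⟨LinearMap.codRestrict N (g ∘ₗ P.mkQ ∘ₗ h) (fun y => hgN ⟨_, rfl⟩), fun x => ?_⟩
  apply Subtype.ext
  have := hg (k x)
  simp only [LinearMap.codRestrict_apply, LinearMap.comp_apply, hh]
  exact this

/-- Every module has an injective envelope. -/
theorem exists_isInjectiveEnvelope {Λ : Type u} [Ring Λ] (M : ModuleCat.{u} Λ) :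
    ∃ (E : ModuleCat.{u} Λ) (f : M ⟶ E), IsInjectiveEnvelope f := by
  let U : ModuleCat.{u} Λ := Injective.under M
  have hE : Module.Injective Λ U :=
    (Module.injective_iff_injective_object Λ U).2 (Injective.injective_under M)
  have hι : Function.Injective (Injective.ι M).hom :=
    (ModuleCat.mono_iff_injective _).1 inferInstance
  obtain ⟨N, hAN, hess, hN⟩ :=
    exists_injective_essential_extension (E := U) (LinearMap.range (Injective.ι M).hom)
  have hmem : ∀ m, (Injective.ι M).hom m ∈ N := fun m => hAN ⟨m, rfl⟩
  refine ⟨ModuleCat.of Λ N, ModuleCat.ofHom (LinearMap.codRestrict N (Injective.ι M).hom hmem),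
    (Module.injective_iff_injective_object Λ _).1 hN, ?_, ?_⟩
  · rw [ModuleCat.mono_iff_injective]
    intro x y hxy
    exact hι (congrArg Subtype.val hxy)
  · intro K hK
    rw [eq_bot_iff]
    intro x hx
    by_contra hx0
    obtain ⟨r, hr0, m, hm⟩ := hess x.1 x.2 (fun h => hx0 (Subtype.ext h))
    have hmemK : r • x ∈ K ⊓ LinearMap.range (ModuleCat.ofHom
        (LinearMap.codRestrict N (Injective.ι M).hom hmem)).hom :=
      ⟨K.smul_mem r hx, m, Subtype.ext hm⟩
    rw [hK] at hmemK
    exact hr0 (congrArg Subtype.val hmemK)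

section

variable {Λ : Type u} [Ring Λ]

/-- The injective envelope `I(M)` of a module `M`. -/
def envelope (M : ModuleCat.{u} Λ) : ModuleCat.{u} Λ :=
  (exists_isInjectiveEnvelope M).choose

/-- The inclusion of a module into its injective envelope. -/
def envelopeι (M : ModuleCat.{u} Λ) : M ⟶ envelope M :=
  (exists_isInjectiveEnvelope M).choose_spec.choose

theorem isInjectiveEnvelope_envelopeι (M : ModuleCat.{u} Λ) :
    IsInjectiveEnvelope (envelopeι M) :=
  (exists_isInjectiveEnvelope M).choose_spec.choose_spec

/-- The `i`-th cosyzygy of `M`: the `0`-th one is `M`, and the next one is the cokernel of the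
inclusion of the current one into its injective envelope. -/
def cosyzygy (M : ModuleCat.{u} Λ) : ℕ → ModuleCat.{u} Λ
  | 0 => M
  | i + 1 => ModuleCat.of Λ
      (envelope (cosyzygy M i) ⧸ LinearMap.range (envelopeι (cosyzygy M i)).hom)

/-- The `i`-th term `Iⁱ(M)` of the minimal injective resolution
`0 → M → I⁰(M) → I¹(M) → ⋯` of `M`. -/
def minInj (M : ModuleCat.{u} Λ) (i : ℕ) : ModuleCat.{u} Λ :=
  envelope (cosyzygy M i)

end

/-! ### Global dimension and higher Auslander algebras -/

/-- The (left) global dimension of a ring: the supremum of the projective dimensions of its left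
modules. -/
def glDim (Λ : Type u) [Ring Λ] : WithBot ℕ∞ :=
  ⨆ M : ModuleCat.{u} Λ, projectiveDimension M

/-- The regular left module `Λ`. -/
abbrev regular (Λ : Type u) [Ring Λ] : ModuleCat.{u} Λ := ModuleCat.of Λ Λ

/-- `Λ` is an `m`-Auslander algebra (`m` a positive integer, `Λ` an Artin algebra):
`gl.dim Λ ≤ m + 1` and `I⁰(Λ), …, Iᵐ(Λ)` are projective. -/
structure IsAuslanderAlgebra (m : ℕ) (Λ : Type u) [Ring Λ] : Prop where
  glDim_le : glDim Λ ≤ ((m + 1 : ℕ) : WithBot ℕ∞)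
  projective : ∀ i ≤ m, Projective (minInj (regular Λ) i)

/-- `I¹(Λ) ⊕ ⋯ ⊕ Iᵐ(Λ)`. -/
def sumMinInj (m : ℕ) (Λ : Type u) [Ring Λ] : ModuleCat.{u} Λ :=
  ModuleCat.of Λ (DirectSum (Finset.Icc 1 m) fun i => minInj (regular Λ) i)

/-! ### Maximal orthogonal subcategories

Full subcategories of `mod Λ` are given by the property of belonging to them. -/

section

variable {Λ : Type u} [Ring Λ]

/-- Every object of `𝒟` has a left `𝒞`-approximation. -/
def CovariantlyFinite (𝒞 𝒟 : ObjectProperty (ModuleCat.{u} Λ)) : Prop :=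
  ∀ D, 𝒟 D → ∃ (C : ModuleCat.{u} Λ) (f : D ⟶ C), 𝒞 C ∧
    ∀ C', 𝒞 C' → ∀ g : D ⟶ C', ∃ h : C ⟶ C', f ≫ h = g

/-- Every object of `𝒟` has a right `𝒞`-approximation. -/
def ContravariantlyFinite (𝒞 𝒟 : ObjectProperty (ModuleCat.{u} Λ)) : Prop :=
  ∀ D, 𝒟 D → ∃ (C : ModuleCat.{u} Λ) (f : C ⟶ D), 𝒞 C ∧
    ∀ C', 𝒞 C' → ∀ g : C' ⟶ D, ∃ h : C' ⟶ C, h ≫ f = g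

/-- The finitely generated modules `X` with `Extⁱ(X, C) = 0` for all `C` in `𝒞`, `1 ≤ i ≤ m`. -/
def leftPerp (m : ℕ) (𝒞 : ObjectProperty (ModuleCat.{u} Λ)) : ObjectProperty (ModuleCat.{u} Λ) :=
  fun X => Module.Finite Λ X ∧
    ∀ C, 𝒞 C → ∀ i : ℕ, 1 ≤ i → i ≤ m → Subsingleton (Abelian.Ext X C i)

/-- The finitely generated modules `X` with `Extⁱ(C, X) = 0` for all `C` in `𝒞`, `1 ≤ i ≤ m`. -/
def rightPerp (m : ℕ) (𝒞 : ObjectProperty (ModuleCat.{u} Λ)) : ObjectProperty (ModuleCat.{u} Λ) :=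
  fun X => Module.Finite Λ X ∧
    ∀ C, 𝒞 C → ∀ i : ℕ, 1 ≤ i → i ≤ m → Subsingleton (Abelian.Ext C X i)

/-- `𝒞` is a maximal `m`-orthogonal subcategory of the full subcategory `𝒟` of `mod Λ`. -/
structure IsMaximalOrthogonal (m : ℕ) (𝒞 𝒟 : ObjectProperty (ModuleCat.{u} Λ)) : Prop where
  le : 𝒞 ≤ 𝒟
  covariantlyFinite : CovariantlyFinite 𝒞 𝒟
  contravariantlyFinite : ContravariantlyFinite 𝒞 𝒟
  eq_left : 𝒞 = leftPerp m 𝒞 ⊓ 𝒟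
  eq_right : 𝒞 = rightPerp m 𝒞 ⊓ 𝒟

end

end

end HigherAuslander

/-!
If `E` is the minimal injective cogenerator of a commutative artinian base ring, `W = Hom(Λ, E)`
gives a duality between the finitely generated modules over `Λ` and over `Λᵐᵒᵖ`. Put `m = n - 1`,
so that statement 1 says that `Λ` has dominant dimension at least `m + 1`.

A maximal `m`-orthogonal subcategory contains the finitely generated injective modules `J` and the
finitely generated projective modules `P`, whence `Extⁱ(J, P) = 0` for `1 ≤ i ≤ m`. By dimension
shifting, a finitely generated injective of projective dimension at most `m` is therefore
projective; dually, a finitely generated projective of injective dimension at most `m` is injective,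
which the duality turns into the same property of the injectives over `Λᵐᵒᵖ`. So statement 2 makes
`I¹(Λ), …, Iᵐ(Λ)` projective. As `gl.dim Λ ≤ m + 1`, the first cosyzygy of `Λ` then has projective
dimension at most one; hence so has `I⁰(Λ)`, which is thus projective as well. In the same way
statement 3 says that `Λᵐᵒᵖ` has dominant dimension at least `m + 1`.

Dominant dimension is left-right symmetric. If `Λ` has a coresolution of length `n` by
projective-injectives, every finitely generated `K` of injective dimension less than `n` is a
quotient of a projective-injective, with a kernel whose injective dimension is larger by at most
one. Iterating this from the injective module `K` dual to `Λᵐᵒᵖ` and dualizing the exact sequence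
obtained gives a projective-injective coresolution of `Λᵐᵒᵖ`, and the terms of the minimal injective
resolution are retracts of its terms.
-/

namespace HigherAuslander

noncomputable section

/-! ### Coresolutions and dimension shifting -/

section Abelian

open Abelian

universe v w

variable {𝒜 : Type u} [Category.{v} 𝒜] [Abelian 𝒜]

/-- `HasCoresolution 𝒬 k X`: there is an exact sequence `0 → X → Q⁰ → ⋯ → Qᵏ⁻¹` all of whose
terms `Qⁱ` satisfy `𝒬`. It is spliced from short exact sequences `0 → X → Q⁰ → X' → 0`, so no map
`Qᵏ⁻¹ → Qᵏ` is recorded. -/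
inductive HasCoresolution (𝒬 : ObjectProperty 𝒜) : ℕ → 𝒜 → Prop
  | zero (X : 𝒜) : HasCoresolution 𝒬 0 X
  | succ {S : ShortComplex 𝒜} (hS : S.ShortExact) (hQ : 𝒬 S.X₂) {k : ℕ}
      (hC : HasCoresolution 𝒬 k S.X₃) : HasCoresolution 𝒬 (k + 1) S.X₁

/-- Every object of `𝒟` has a syzygy in `𝒟` with respect to `𝒬`: it is the right end of a short
exact sequence with left end in `𝒟` and middle term in `𝒬`. -/
def HasSyzygies (𝒟 𝒬 : ObjectProperty 𝒜) : Prop :=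
  ∀ M, 𝒟 M → ∃ S : ShortComplex 𝒜, S.ShortExact ∧ 𝒟 S.X₁ ∧ 𝒬 S.X₂ ∧ S.X₃ = M

/-- Every object of `𝒟` has a cosyzygy in `𝒟` with respect to `𝒬`: it is the left end of a short
exact sequence with middle term in `𝒬` and right end in `𝒟`. -/
def HasCosyzygies (𝒟 𝒬 : ObjectProperty 𝒜) : Prop :=
  ∀ M, 𝒟 M → ∃ S : ShortComplex 𝒜, S.ShortExact ∧ S.X₁ = M ∧ 𝒬 S.X₂ ∧ 𝒟 S.X₃

variable [HasExt.{w} 𝒜]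

theorem HasCoresolution.subsingleton_ext {𝒬 : ObjectProperty 𝒜}
    (h𝒬 : 𝒬 ≤ isProjective 𝒜) {k m : ℕ} {X K : 𝒜} (hX : HasCoresolution 𝒬 k X)
    (hK : HasInjectiveDimensionLT K (k + m)) (hm : 1 ≤ m) : Subsingleton (Ext X K m) := by
  induction hX generalizing m with
  | zero X => exact HasInjectiveDimensionLT.subsingleton K (0 + m) m (by omega) X
  | @succ S hS hQ k _ ih =>
    have : Projective S.X₂ := h𝒬 _ hQ
    refine subsingleton_of_forall_eq 0 fun e => ?_
    have := ih (m := m + 1) (by rwa [add_assoc, add_comm 1 m] at hK) (by omega)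
    obtain ⟨x, rfl⟩ := Ext.contravariant_sequence_exact₁ hS K e (add_comm 1 m)
      (Subsingleton.elim _ _)
    rw [x.eq_zero_of_hasProjectiveDimensionLT 1 hm, Ext.comp_zero]

theorem exists_factorThru_of_subsingleton_ext {S : ShortComplex 𝒜} (hS : S.ShortExact) {K : 𝒜}
    [Subsingleton (Ext S.X₃ K 1)] (q : S.X₁ ⟶ K) : ∃ p : S.X₂ ⟶ K, S.f ≫ p = q := by
  obtain ⟨φ, hφ⟩ := Ext.contravariant_sequence_exact₁ hS K (Ext.mk₀ q) (add_zero 1)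
    (Subsingleton.elim _ _)
  obtain ⟨p, rfl⟩ := Ext.homEquiv₀.symm.surjective φ
  rw [Ext.homEquiv₀_symm_apply, Ext.mk₀_comp_mk₀] at hφ
  exact ⟨p, Ext.homEquiv₀.symm.injective hφ⟩

theorem exists_splitting_of_subsingleton_ext {S : ShortComplex 𝒜} (hS : S.ShortExact)
    [Subsingleton (Ext S.X₃ S.X₁ 1)] : Nonempty S.Splitting := by
  obtain ⟨r, hr⟩ := exists_factorThru_of_subsingleton_ext hS (𝟙 S.X₁)
  exact ⟨.ofExactOfRetraction S hS.exact r hr hS.epi_g⟩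

theorem HasCoresolution.exists_factorThru {𝒬 : ObjectProperty 𝒜}
    (h𝒬 : 𝒬 ≤ isProjective 𝒜) {k : ℕ} {X K : 𝒜}
    (hX : HasCoresolution 𝒬 (k + 1) X) (hK : HasInjectiveDimensionLT K (k + 1)) (q : X ⟶ K) :
    ∃ (Q : 𝒜) (_ : 𝒬 Q) (f : X ⟶ Q) (p : Q ⟶ K), f ≫ p = q := by
  obtain _ | @⟨S, hS, hQ, _, hC⟩ := hX
  have := hC.subsingleton_ext h𝒬 hK le_rfl
  obtain ⟨p, hp⟩ := exists_factorThru_of_subsingleton_ext hS q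
  exact ⟨S.X₂, hQ, S.f, p, hp⟩

variable {𝒟 𝒬 : ObjectProperty 𝒜} {X : 𝒜} {d : ℕ}

theorem HasSyzygies.subsingleton_ext
    (h𝒟 : HasSyzygies 𝒟 𝒬) (hX : HasProjectiveDimensionLT X (d + 1))
    (hExt : ∀ Q, 𝒬 Q → ∀ i : ℕ, 1 ≤ i → i ≤ d → Subsingleton (Ext X Q i))
    {M : 𝒜} (hM : 𝒟 M) {i : ℕ} (hi : 1 ≤ i) : Subsingleton (Ext X M i) := by
  obtain hid | hid := Nat.lt_or_ge d i
  · exact HasProjectiveDimensionLT.subsingleton X (d + 1) i hid M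
  obtain ⟨S, hS, hK, hQ, rfl⟩ := h𝒟 M hM
  have := h𝒟.subsingleton_ext hX hExt hK (i := i + 1) (by omega)
  have := hExt _ hQ i hi hid
  refine subsingleton_of_forall_eq 0 fun x => ?_
  obtain ⟨y, rfl⟩ := Ext.covariant_sequence_exact₃ X hS x rfl (Subsingleton.elim _ _)
  rw [Subsingleton.elim y 0, Ext.zero_comp]
termination_by d + 1 - i

theorem HasSyzygies.exists_retract
    (h𝒟 : HasSyzygies 𝒟 𝒬) (hX : HasProjectiveDimensionLT X (d + 1))
    (hExt : ∀ Q, 𝒬 Q → ∀ i : ℕ, 1 ≤ i → i ≤ d → Subsingleton (Ext X Q i)) (hX𝒟 : 𝒟 X) :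
    ∃ Q, 𝒬 Q ∧ Nonempty (Retract X Q) := by
  obtain ⟨S, hS, hK, hQ, rfl⟩ := h𝒟 X hX𝒟
  have := h𝒟.subsingleton_ext hX hExt hK le_rfl
  obtain ⟨σ⟩ := exists_splitting_of_subsingleton_ext hS
  exact ⟨S.X₂, hQ, ⟨σ.s, S.g, σ.s_g⟩⟩

theorem HasCosyzygies.subsingleton_ext
    (h𝒟 : HasCosyzygies 𝒟 𝒬) (hX : HasInjectiveDimensionLT X (d + 1))
    (hExt : ∀ Q, 𝒬 Q → ∀ i : ℕ, 1 ≤ i → i ≤ d → Subsingleton (Ext Q X i))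
    {M : 𝒜} (hM : 𝒟 M) {i : ℕ} (hi : 1 ≤ i) : Subsingleton (Ext M X i) := by
  obtain hid | hid := Nat.lt_or_ge d i
  · exact HasInjectiveDimensionLT.subsingleton X (d + 1) i hid M
  obtain ⟨S, hS, rfl, hQ, hC⟩ := h𝒟 M hM
  have := h𝒟.subsingleton_ext hX hExt hC (i := i + 1) (by omega)
  have := hExt _ hQ i hi hid
  refine subsingleton_of_forall_eq 0 fun x => ?_
  obtain ⟨y, rfl⟩ := Ext.contravariant_sequence_exact₁ hS X x (add_comm 1 i)
    (Subsingleton.elim _ _)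
  rw [Subsingleton.elim y 0, Ext.comp_zero]
termination_by d + 1 - i

theorem HasCosyzygies.exists_retract
    (h𝒟 : HasCosyzygies 𝒟 𝒬) (hX : HasInjectiveDimensionLT X (d + 1))
    (hExt : ∀ Q, 𝒬 Q → ∀ i : ℕ, 1 ≤ i → i ≤ d → Subsingleton (Ext Q X i)) (hX𝒟 : 𝒟 X) :
    ∃ Q, 𝒬 Q ∧ Nonempty (Retract X Q) := by
  obtain ⟨S, hS, rfl, hQ, hC⟩ := h𝒟 X hX𝒟
  have := h𝒟.subsingleton_ext hX hExt hC le_rfl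
  obtain ⟨σ⟩ := exists_splitting_of_subsingleton_ext hS
  exact ⟨S.X₂, hQ, ⟨S.f, σ.r, σ.f_r⟩⟩

end Abelian

/-! ### Minimal injective resolutions -/

section Envelope

variable {A : Type u} [Ring A]

theorem IsInjectiveEnvelope.mono_of_comp {M E N : ModuleCat.{u} A} {f : M ⟶ E}
    (hf : IsInjectiveEnvelope f) (g : E ⟶ N) [Mono (f ≫ g)] : Mono g := by
  have hfg : Function.Injective (f ≫ g).hom := (ModuleCat.mono_iff_injective _).1 inferInstance
  rw [ModuleCat.mono_iff_ker_eq_bot]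
  refine hf.essential _ ((Submodule.eq_bot_iff _).2 ?_)
  rintro _ ⟨hx, x, rfl⟩
  rw [show x = 0 from hfg (by rw [map_zero]; exact hx), map_zero]

theorem IsInjectiveEnvelope.isIso_of_comp_eq {M E : ModuleCat.{u} A} {f : M ⟶ E}
    (hf : IsInjectiveEnvelope f) {g : E ⟶ E} (hg : f ≫ g = f) : IsIso g := by
  have := hf.injective
  have : Mono (f ≫ g) := hg.symm ▸ hf.mono
  have := hf.mono_of_comp g
  let ρ : E ⟶ E := Injective.factorThru (𝟙 E) g
  have hρ : g ≫ ρ = 𝟙 E := Injective.comp_factorThru _ _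
  have hfρ : f ≫ ρ = f := by rw [← hg, Category.assoc, hρ, Category.comp_id, hg]
  have : Mono (f ≫ ρ) := hfρ.symm ▸ hf.mono
  have := hf.mono_of_comp ρ
  have : IsSplitEpi ρ := ⟨⟨g, hρ⟩⟩
  have := isIso_of_mono_of_isSplitEpi ρ
  have : IsIso (g ≫ ρ) := hρ.symm ▸ inferInstance
  exact IsIso.of_isIso_comp_right g ρ

theorem exists_shortComplex_hom {S T : ShortComplex (ModuleCat.{u} A)} (hS : S.ShortExact)
    (a : S.X₁ ⟶ T.X₁) (b : S.X₂ ⟶ T.X₂) (h : a ≫ T.f = S.f ≫ b) :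
    ∃ φ : S ⟶ T, φ.τ₁ = a ∧ φ.τ₂ = b := by
  have := hS.epi_g
  exact ⟨ShortComplex.homMk a b
    (hS.exact.desc (b ≫ T.g) (by rw [← Category.assoc, ← h, Category.assoc, T.zero,
      Limits.comp_zero])) h (hS.exact.g_desc _ _).symm, rfl, rfl⟩

theorem IsInjectiveEnvelope.nonempty_retract {S T : ShortComplex (ModuleCat.{u} A)}
    (hS : S.ShortExact) (hT : T.ShortExact) (hf : IsInjectiveEnvelope S.f) [Injective T.X₂]
    (r : Retract S.X₁ T.X₁) : Nonempty (Retract S T) := by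
  have := hf.injective
  have := hS.mono_f
  have := hS.epi_g
  have := hT.mono_f
  let u : S.X₂ ⟶ T.X₂ := Injective.factorThru (r.i ≫ T.f) S.f
  let v : T.X₂ ⟶ S.X₂ := Injective.factorThru (r.r ≫ S.f) T.f
  have hu : S.f ≫ u = r.i ≫ T.f := Injective.comp_factorThru _ _
  have hv : T.f ≫ v = r.r ≫ S.f := Injective.comp_factorThru _ _
  have huv : S.f ≫ u ≫ v = S.f := by rw [reassoc_of% hu, hv, r.retract_assoc]
  have : IsIso (u ≫ v) := hf.isIso_of_comp_eq huv
  have hv' : r.r ≫ S.f = T.f ≫ v ≫ inv (u ≫ v) := by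
    rw [reassoc_of% hv, (IsIso.comp_inv_eq (u ≫ v)).2 huv.symm]
  obtain ⟨i, hi₁, hi₂⟩ := exists_shortComplex_hom hS r.i u hu.symm
  obtain ⟨p, hp₁, hp₂⟩ := exists_shortComplex_hom hT r.r (v ≫ inv (u ≫ v)) hv'
  have h₁ : (i ≫ p).τ₁ = 𝟙 S.X₁ := by rw [ShortComplex.comp_τ₁, hi₁, hp₁, r.retract]
  have h₂ : (i ≫ p).τ₂ = 𝟙 S.X₂ := by
    rw [ShortComplex.comp_τ₂, hi₂, hp₂, ← Category.assoc, IsIso.hom_inv_id]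
  have h₃ : (i ≫ p).τ₃ = 𝟙 S.X₃ := by
    rw [← cancel_epi S.g, ← (i ≫ p).comm₂₃, h₂, Category.id_comp, Category.comp_id]
  exact ⟨i, p, ShortComplex.hom_ext _ _ h₁ h₂ h₃⟩

instance injective_envelope (M : ModuleCat.{u} A) : Injective (envelope M) :=
  (isInjectiveEnvelope_envelopeι M).injective

instance injective_minInj (M : ModuleCat.{u} A) (i : ℕ) : Injective (minInj M i) :=
  injective_envelope _

instance mono_envelopeι (M : ModuleCat.{u} A) : Mono (envelopeι M) :=
  (isInjectiveEnvelope_envelopeι M).mono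

theorem cosyzygy_succ (M : ModuleCat.{u} A) (i : ℕ) :
    cosyzygy M (i + 1) = cosyzygy (cosyzygy M 1) i := by
  induction i with
  | zero => rfl
  | succ i ih =>
    rw [cosyzygy, ih]
    rfl

theorem minInj_succ (M : ModuleCat.{u} A) (i : ℕ) :
    minInj M (i + 1) = minInj (cosyzygy M 1) i :=
  congrArg envelope (cosyzygy_succ M i)

/-- The `i`-th step `0 → Ωⁱ → Iⁱ(M) → Ωⁱ⁺¹ → 0` of the minimal injective resolution of `M`, where
`Ωⁱ` is the `i`-th cosyzygy. -/
def cosyzygyShortComplex (M : ModuleCat.{u} A) (i : ℕ) : ShortComplex (ModuleCat.{u} A) :=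
  ModuleCat.shortComplexOfCompEqZero (envelopeι (cosyzygy M i)).hom
    (LinearMap.range (envelopeι (cosyzygy M i)).hom).mkQ (LinearMap.range_mkQ_comp _)

theorem shortExact_cosyzygyShortComplex (M : ModuleCat.{u} A) (i : ℕ) :
    (cosyzygyShortComplex M i).ShortExact :=
  ModuleCat.shortComplex_shortExact _ (LinearMap.exact_map_mkQ_range _)
    ((ModuleCat.mono_iff_injective _).1 (mono_envelopeι _)) (Submodule.mkQ_surjective _)

theorem projective_minInj_of_hasCoresolution {𝒬 : ObjectProperty (ModuleCat.{u} A)}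
    (h𝒬 : 𝒬 ≤ isProjective _ ⊓ isInjective _) {k : ℕ} {X Y : ModuleCat.{u} A}
    (hY : HasCoresolution 𝒬 k Y) (r : Retract X Y) {i : ℕ} (hi : i < k) :
    Projective (minInj X i) := by
  induction hY generalizing X i with
  | zero => omega
  | @succ S hS hQ k _ ih =>
    have : Projective S.X₂ := (h𝒬 _ hQ).1
    have : Injective S.X₂ := (h𝒬 _ hQ).2
    obtain ⟨ρ⟩ := IsInjectiveEnvelope.nonempty_retract (shortExact_cosyzygyShortComplex X 0) hS
      (isInjectiveEnvelope_envelopeι X) r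
    obtain _ | i := i
    · have ρ₂ : Retract (minInj X 0) S.X₂ := ρ.map ShortComplex.π₂
      exact ρ₂.projective
    · rw [minInj_succ]
      exact ih (ρ.map ShortComplex.π₃) (by omega)

theorem hasCoresolution_of_minInj {𝒬 : ObjectProperty (ModuleCat.{u} A)} {k : ℕ}
    (M : ModuleCat.{u} A) (h : ∀ i < k, 𝒬 (minInj M i)) : HasCoresolution 𝒬 k M := by
  induction k generalizing M with
  | zero => exact .zero M
  | succ k ih =>
    refine .succ (shortExact_cosyzygyShortComplex M 0) (h 0 k.succ_pos)
      (ih (cosyzygy M 1) fun i hi => ?_)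
    rw [← minInj_succ]
    exact h (i + 1) (by omega)

end Envelope

/-! ### Dominant dimension -/

section DominantDimension

variable {A : Type u} [Ring A]

/-- The left dominant dimension of `A` is at least `n`: the terms `I⁰(A), …, Iⁿ⁻¹(A)` of the minimal
injective resolution of the regular left module are projective. -/
def HasDominantDimensionGE (n : ℕ) (A : Type u) [Ring A] : Prop :=
  ∀ i < n, Projective (minInj (regular A) i)

theorem hasProjectiveDimensionLT_cosyzygy {M : ModuleCat.{u} A} {n : ℕ}
    (hn : HasProjectiveDimensionLT (cosyzygy M n) (n + 1))
    (hI : ∀ i, 1 ≤ i → i < n → Projective (minInj M i)) {i : ℕ} (hi : 1 ≤ i) (hin : i ≤ n) :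
    HasProjectiveDimensionLT (cosyzygy M i) (i + 1) := by
  obtain rfl | hin := hin.eq_or_lt
  · exact hn
  have := hI i hi hin
  exact (shortExact_cosyzygyShortComplex M i).hasProjectiveDimensionLT_X₁ (i + 1)
    (hasProjectiveDimensionLT_of_ge (minInj M i) 1 (i + 1) (by omega))
    (hasProjectiveDimensionLT_cosyzygy hn hI (i := i + 1) (by omega) hin)
termination_by n - i

theorem hasProjectiveDimensionLT_minInj_zero {M : ModuleCat.{u} A} [Projective M]
    (hΩ : HasProjectiveDimensionLT (cosyzygy M 1) 2) :
    HasProjectiveDimensionLT (minInj M 0) 2 :=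
  (shortExact_cosyzygyShortComplex M 0).hasProjectiveDimensionLT_X₂ 2
    (hasProjectiveDimensionLT_of_ge M 1 2 (by omega)) hΩ

theorem nonempty_retract_sumMinInj {m i : ℕ} (hi : 1 ≤ i) (him : i ≤ m) :
    Nonempty (Retract (minInj (regular A) i) (sumMinInj m A)) :=
  let M := fun j : Finset.Icc 1 m => minInj (regular A) j
  let j : Finset.Icc 1 m := ⟨i, Finset.mem_Icc.2 ⟨hi, him⟩⟩
  ⟨{  i := ModuleCat.ofHom (DirectSum.lof A _ (fun j => M j) j)
      r := ModuleCat.ofHom (DirectSum.component A _ (fun j => M j) j)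
      retract := ModuleCat.hom_ext (LinearMap.ext fun x =>
        DirectSum.component.lof_self A (M := fun j : Finset.Icc 1 m => minInj (regular A) j) j x) }⟩

theorem HasDominantDimensionGE.projective_sumMinInj {m : ℕ}
    (h : HasDominantDimensionGE (m + 1) A) : Projective (sumMinInj m A) := by
  have (i : Finset.Icc 1 m) : Module.Projective A (minInj (regular A) i) :=
    (IsProjective.iff_projective _).2 (h i (Nat.lt_succ_of_le (Finset.mem_Icc.1 i.2).2))
  exact (IsProjective.iff_projective _).1
    (inferInstanceAs (Module.Projective A (DirectSum _ fun i : Finset.Icc 1 m =>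
      minInj (regular A) i)))

theorem HasDominantDimensionGE.projectiveDimension_sumMinInj_le {m : ℕ}
    (h : HasDominantDimensionGE (m + 1) A) :
    projectiveDimension (sumMinInj m A) ≤ (m : WithBot ℕ∞) := by
  have := h.projective_sumMinInj
  exact (projectiveDimension_le_iff _ m).2 (hasProjectiveDimensionLT_of_ge _ 1 _ (by omega))

theorem hasDominantDimensionGE_of_projectiveDimension_sumMinInj_le {m : ℕ} (hm : 1 ≤ m)
    (hΩ : HasProjectiveDimensionLT (cosyzygy (regular A) (m + 1)) (m + 2))
    (hI : ∀ i, HasProjectiveDimensionLT (minInj (regular A) i) (m + 1) →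
      Projective (minInj (regular A) i))
    (hsum : projectiveDimension (sumMinInj m A) ≤ (m : WithBot ℕ∞)) :
    HasDominantDimensionGE (m + 1) A := by
  have hpos : ∀ i, 1 ≤ i → i < m + 1 → Projective (minInj (regular A) i) := fun i hi him => by
    obtain ⟨r⟩ := nonempty_retract_sumMinInj (A := A) hi (Nat.le_of_lt_succ him)
    have := (projectiveDimension_le_iff _ m).1 hsum
    exact hI i (r.hasProjectiveDimensionLT (m + 1))
  have hzero : HasProjectiveDimensionLT (minInj (regular A) 0) 2 :=
    hasProjectiveDimensionLT_minInj_zero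
      (hasProjectiveDimensionLT_cosyzygy hΩ hpos le_rfl (by omega))
  intro i hi
  obtain rfl | hi0 := Nat.eq_zero_or_pos i
  · exact hI 0 (hasProjectiveDimensionLT_of_ge _ 2 _ (by omega))
  · exact hpos i hi0 hi

variable {n : ℕ}

theorem hasProjectiveDimensionLT_of_glDim_le (h : glDim A ≤ (n : WithBot ℕ∞))
    (M : ModuleCat.{u} A) : HasProjectiveDimensionLT M (n + 1) :=
  (projectiveDimension_le_iff M n).1 ((le_iSup _ M).trans h)

theorem hasInjectiveDimensionLT_of_glDim_le (h : glDim A ≤ (n : WithBot ℕ∞))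
    (M : ModuleCat.{u} A) : HasInjectiveDimensionLT M (n + 1) :=
  .mk fun _ hi X e =>
    have := hasProjectiveDimensionLT_of_glDim_le h X
    e.eq_zero_of_hasProjectiveDimensionLT (n + 1) hi

end DominantDimension

/-! ### Matlis modules -/

section Matlis

/-- Homomorphisms into `W` separate the elements of every `A`-module. -/
def IsCogenerator (A W : Type u) [Ring A] [AddCommGroup W] [Module A W] : Prop :=
  ∀ (M : Type u) [AddCommGroup M] [Module A M] (m : M), m ≠ 0 → ∃ f : M →ₗ[A] W, f m ≠ 0

theorem isCogenerator_of_injective {A W : Type u} [Ring A] [AddCommGroup W] [Module A W]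
    (hW : Module.Injective A W)
    (h : ∀ I : Submodule A A, IsCoatom I → ∃ f : (A ⧸ I) →ₗ[A] W, Function.Injective f) :
    IsCogenerator A W := by
  intro M _ _ m hm
  have hann : LinearMap.ker (LinearMap.toSpanSingleton A M m) ≠ ⊤ := fun htop =>
    hm (by simpa using LinearMap.congr_fun (LinearMap.ker_eq_top.1 htop) 1)
  obtain ⟨I, hI, hle⟩ := IsCoatomic.eq_top_or_exists_le_coatom _ |>.resolve_left hann
  obtain ⟨f, hf⟩ := h I hI
  let j := (LinearMap.ker (LinearMap.toSpanSingleton A M m)).liftQ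
    (LinearMap.toSpanSingleton A M m) le_rfl
  have hj : Function.Injective j := LinearMap.ker_eq_bot.1 (Submodule.ker_liftQ_eq_bot _ _ _ le_rfl)
  obtain ⟨g, hg⟩ := hW.out j hj (f ∘ₗ Submodule.mapQ _ I LinearMap.id hle)
  refine ⟨g, fun hgm => hI.1 ?_⟩
  have hone : f (I.mkQ 1) = 0 := by
    rw [← hgm, ← one_smul A m]
    exact (hg (Submodule.Quotient.mk 1)).symm
  rw [Ideal.eq_top_iff_one]
  exact (Submodule.Quotient.mk_eq_zero I).1 (hf (hone.trans (map_zero f).symm))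

theorem IsInjectiveEnvelope.range_le_of_isSimpleModule {A : Type u} [Ring A]
    {M E : ModuleCat.{u} A} {ι : M ⟶ E} (hι : IsInjectiveEnvelope ι) {S : Type*} [AddCommGroup S]
    [Module A S] [IsSimpleModule A S] (f : S →ₗ[A] E) :
    LinearMap.range f ≤ LinearMap.range ι.hom := by
  obtain hf | rfl := f.injective_or_eq_zero
  · have := IsSimpleModule.congr (LinearEquiv.ofInjective f hf).symm
    have hatom : IsAtom (LinearMap.range f) := isSimpleModule_iff_isAtom.1 this
    exact hatom.not_disjoint_iff_le.1 fun h => hatom.1 (hι.essential _ h.eq_bot)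
  · simp

theorem length_le_one_of_forall_exists_smul {R M : Type*} [Ring R] [AddCommGroup M] [Module R M]
    (h : ∀ x y : M, x ≠ 0 → ∃ r : R, r • x = y) : Module.length R M ≤ 1 := by
  obtain hM | hM := subsingleton_or_nontrivial M
  · simp
  · have : IsSimpleModule R M :=
      isSimpleModule_iff_toSpanSingleton_surjective.2 ⟨hM, fun x hx y => h x y hx⟩
    simp

variable {R : Type u} [CommRing R]

theorem exists_smul_eq_of_mem_pi_quotient (I : Ideal R) [hI : I.IsMaximal]
    {x y : ∀ J : MaximalSpectrum R, R ⧸ J.asIdeal} (hx0 : x ≠ 0)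
    (hx : ∀ a ∈ I, a • x = 0) (hy : ∀ a ∈ I, a • y = 0) : ∃ r : R, r • x = y := by
  have hsupp {z : ∀ J : MaximalSpectrum R, R ⧸ J.asIdeal} (hz : ∀ a ∈ I, a • z = 0)
      (J : MaximalSpectrum R) (hJ : J ≠ ⟨I, hI⟩) : z J = 0 := by
    obtain ⟨a, haI, haJ⟩ : ∃ a ∈ I, a ∉ J.asIdeal := Set.not_subset.1 fun h =>
      hJ (MaximalSpectrum.ext (hI.eq_of_le J.isMaximal.ne_top h).symm)
    have ha : Ideal.Quotient.mk J.asIdeal a * z J = 0 := congrFun (hz a haI) J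
    exact (mul_eq_zero.1 ha).resolve_left (Ideal.Quotient.eq_zero_iff_mem.not.2 haJ)
  have hxI : x ⟨I, hI⟩ ≠ 0 := fun h => hx0 <| funext fun J => by
    by_cases hJ : J = ⟨I, hI⟩
    · exact hJ ▸ h
    · exact hsupp hx J hJ
  let _ := Ideal.Quotient.field I
  obtain ⟨r, hr⟩ := Ideal.Quotient.mk_surjective (y ⟨I, hI⟩ / x ⟨I, hI⟩)
  refine ⟨r, funext fun J => ?_⟩
  by_cases hJ : J = ⟨I, hI⟩
  · subst hJ
    change Ideal.Quotient.mk I r * x ⟨I, hI⟩ = _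
    rw [hr, div_mul_cancel₀ _ hxI]
  · rw [Pi.smul_apply, hsupp hx J hJ, hsupp hy J hJ, smul_zero]

theorem IsInjectiveEnvelope.length_hom_le_one {E : ModuleCat.{u} R}
    {ι : ModuleCat.of R (∀ J : MaximalSpectrum R, R ⧸ J.asIdeal) ⟶ E}
    (hι : IsInjectiveEnvelope ι) (S : Type*) [AddCommGroup S] [Module R S] [IsSimpleModule R S] :
    Module.length R (S →ₗ[R] E) ≤ 1 := by
  have hιi : Function.Injective ι.hom := (ModuleCat.mono_iff_injective _).1 hι.mono
  have hsimple := (isSimpleModule_iff_toSpanSingleton_surjective.1 ‹IsSimpleModule R S›).2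
  refine length_le_one_of_forall_exists_smul fun f g hf => ?_
  obtain ⟨s, hs⟩ : ∃ s, f s ≠ 0 := DFunLike.ne_iff.1 hf
  have hs0 : s ≠ 0 := by rintro rfl; exact hs (map_zero f)
  have := IsSimpleModule.ker_toSpanSingleton_isMaximal R hs0
  obtain ⟨x, hx⟩ := hι.range_le_of_isSimpleModule f ⟨s, rfl⟩
  obtain ⟨y, hy⟩ := hι.range_le_of_isSimpleModule g ⟨s, rfl⟩
  have hann {f : S →ₗ[R] E} {x} (hx : ι.hom x = f s) (a : R)
      (ha : a ∈ LinearMap.ker (LinearMap.toSpanSingleton R S s)) : a • x = 0 := by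
    have has : a • s = 0 := ha
    apply hιi
    rw [map_smul, hx, ← map_smul, has, map_zero, map_zero]
  obtain ⟨r, rfl⟩ := exists_smul_eq_of_mem_pi_quotient
    (LinearMap.ker (LinearMap.toSpanSingleton R S s))
    (by rintro rfl; exact hs (hx.symm.trans (map_zero _))) (hann hx) (hann hy)
  refine ⟨r, LinearMap.ext fun s' => ?_⟩
  obtain ⟨t, rfl⟩ := hsimple s hs0 s'
  rw [LinearMap.toSpanSingleton_apply, map_smul, map_smul, LinearMap.smul_apply, ← hx, ← hy,
    map_smul]

/-- An injective cogenerator `E` of the modules over a commutative ring such that `Hom(S, E)` has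
length at most one for every simple module `S`, as for the minimal injective cogenerator. Matlis
duality is the functor `Hom(-, E)`. -/
structure IsMatlisModule (R E : Type u) [CommRing R] [AddCommGroup E] [Module R E] : Prop where
  injective : Module.Injective R E
  isCogenerator : IsCogenerator R E
  length_hom_le_one : ∀ (S : Type u) [AddCommGroup S] [Module R S] [IsSimpleModule R S],
    Module.length R (S →ₗ[R] E) ≤ 1

variable (R) in
theorem isMatlisModule_envelope :
    IsMatlisModule R
      (envelope (ModuleCat.of R (∀ J : MaximalSpectrum R, R ⧸ J.asIdeal))) := by
  have hι := isInjectiveEnvelope_envelopeι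
    (ModuleCat.of R (∀ J : MaximalSpectrum R, R ⧸ J.asIdeal))
  have hinj := (Module.injective_iff_injective_object R _).2 hι.injective
  refine ⟨hinj, isCogenerator_of_injective hinj fun I hI => ?_, fun S => hι.length_hom_le_one S⟩
  classical
  let J : MaximalSpectrum R := ⟨I, ⟨hI⟩⟩
  let s := LinearMap.single R (fun J : MaximalSpectrum R => R ⧸ J.asIdeal) J
  have hs : Function.Injective s :=
    Pi.single_injective (M := fun J : MaximalSpectrum R => R ⧸ J.asIdeal) J
  exact ⟨(envelopeι _).hom ∘ₗ s, ((ModuleCat.mono_iff_injective _).1 hι.mono).comp hs⟩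

theorem length_hom_le_add_of_submodule {M E : Type*} [AddCommGroup M] [Module R M]
    [AddCommGroup E] [Module R E] (N : Submodule R M) :
    Module.length R (M →ₗ[R] E) ≤
      Module.length R ((M ⧸ N) →ₗ[R] E) + Module.length R (N →ₗ[R] E) := by
  let res := LinearMap.lcomp R E N.subtype
  have hexact : Function.Exact (LinearMap.lcomp R E N.mkQ) res.rangeRestrict := by
    rw [LinearMap.exact_iff, LinearMap.ker_rangeRestrict]
    exact LinearMap.exact_iff.1 (LinearMap.exact_lcomp_of_exact_of_surjective E
      (LinearMap.exact_subtype_mkQ N) N.mkQ_surjective)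
  rw [Module.length_eq_add_of_exact _ _
    (LinearMap.lcomp_injective_of_surjective _ N.mkQ_surjective) res.surjective_rangeRestrict
    hexact]
  gcongr
  exact Module.length_le_of_injective _ (LinearMap.range res).injective_subtype

theorem IsMatlisModule.length_hom_le {E M : Type u} [AddCommGroup E] [Module R E]
    (hE : IsMatlisModule R E) [AddCommGroup M] [Module R M]
    (hM : IsFiniteLength R M) : Module.length R (M →ₗ[R] E) ≤ Module.length R M := by
  induction hM with
  | of_subsingleton =>
    rw [Module.length_eq_zero_iff.2 inferInstance]
    exact zero_le
  | @of_simple_quotient M _ _ N _ _ ih =>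
    calc Module.length R (M →ₗ[R] E)
      _ ≤ Module.length R ((M ⧸ N) →ₗ[R] E) + Module.length R (N →ₗ[R] E) :=
        length_hom_le_add_of_submodule N
      _ ≤ Module.length R (M ⧸ N) + Module.length R N := by
        rw [Module.length_eq_one R (M ⧸ N)]
        exact add_le_add (hE.length_hom_le_one _) ih
      _ = Module.length R M := by
        rw [add_comm, Module.length_eq_add_of_exact N.subtype N.mkQ N.subtype_injective
          N.mkQ_surjective (LinearMap.exact_subtype_mkQ N)]

end Matlis

/-! ### Morita dualities -/

section Duality

variable (A B W : Type u) [Ring A] [Ring B] [AddCommGroup W] [Module A W] [Module B W]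

/-- `W` is an injective cogenerator of the `A`-modules, and finitely generated `A`-modules `M` are
reflexive with finitely generated dual `Hom_A(M, W)` over `B`. -/
structure IsDualizing [SMulCommClass A B W] : Prop where
  injective : Module.Injective A W
  isCogenerator : IsCogenerator A W
  finite_hom : ∀ (M : Type u) [AddCommGroup M] [Module A M] [Module.Finite A M],
    Module.Finite B (M →ₗ[A] W)
  exists_eval_eq : ∀ (M : Type u) [AddCommGroup M] [Module A M] [Module.Finite A M]
    (φ : (M →ₗ[A] W) →ₗ[B] W), ∃ m, ∀ f, φ f = f m

/-- `Hom_A(-, W)` and `Hom_B(-, W)` are mutually inverse dualities between the finitely generated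
modules over `A` and over `B`. -/
structure IsMoritaDuality [SMulCommClass A B W] [SMulCommClass B A W] : Prop where
  left : IsDualizing A B W
  right : IsDualizing B A W

variable {A B W} in
theorem IsMoritaDuality.symm [SMulCommClass A B W] [SMulCommClass B A W]
    (hW : IsMoritaDuality A B W) : IsMoritaDuality B A W :=
  ⟨hW.right, hW.left⟩

end Duality

section Coinduced

variable {R E W : Type u} [CommRing R] [AddCommGroup E] [Module R E] [AddCommGroup W] [Module R W]

/-- `t : W → E` is the counit of a coinduced module: it induces a bijection `W ≃ Hom_R(A, E)`. -/
def IsCoinduced (A : Type u) [Ring A] [Algebra R A] [Module A W] [IsScalarTower R A W]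
    (t : W →ₗ[R] E) : Prop :=
  Function.Bijective fun w : W => t ∘ₗ (LinearMap.toSpanSingleton A W w).restrictScalars R

variable {A : Type u} [Ring A] [Algebra R A] [Module A W] [IsScalarTower R A W] {t : W →ₗ[R] E}

theorem IsCoinduced.ext (ht : IsCoinduced A t) {w w' : W} (h : ∀ a : A, t (a • w) = t (a • w')) :
    w = w' :=
  ht.1 (LinearMap.ext h)

theorem IsCoinduced.exists_smul_eq (ht : IsCoinduced A t) (φ : A →ₗ[R] E) :
    ∃ w, ∀ a : A, t (a • w) = φ a :=
  (ht.2 φ).imp fun _ h => LinearMap.congr_fun h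

section

variable (M : Type u) [AddCommGroup M] [Module A M] [Module R M] [IsScalarTower R A M]

theorem IsCoinduced.bijective_comp (ht : IsCoinduced A t) :
    Function.Bijective fun f : M →ₗ[A] W => t ∘ₗ f.restrictScalars R := by
  constructor
  · intro f g h
    ext x
    refine ht.ext fun a => ?_
    rw [← map_smul, ← map_smul]
    exact LinearMap.congr_fun h (a • x)
  · intro φ
    choose f hf using fun x : M =>
      ht.exists_smul_eq (φ ∘ₗ (LinearMap.toSpanSingleton A M x).restrictScalars R)
    replace hf : ∀ x a, t (a • f x) = φ (a • x) := hf
    refine ⟨⟨⟨f, fun x y => ht.ext fun a => ?_⟩, fun b x => ht.ext fun a => ?_⟩,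
      LinearMap.ext fun x => ?_⟩
    · rw [smul_add, map_add, hf, hf, hf, smul_add, map_add]
    · rw [RingHom.id_apply, hf, ← mul_smul, ← mul_smul, hf]
    · simpa only [one_smul] using! hf x 1

/-- Adjunction between restriction of scalars and coinduction: `Hom_A(M, W) ≃ Hom_R(M, E)`. -/
def IsCoinduced.homEquiv (ht : IsCoinduced A t) : (M →ₗ[A] W) ≃ₗ[R] (M →ₗ[R] E) :=
  LinearEquiv.ofBijective
    { toFun := fun f => t ∘ₗ f.restrictScalars R
      map_add' := fun f g => LinearMap.ext fun x => map_add t (f x) (g x)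
      map_smul' := fun r f => LinearMap.ext fun x => map_smul t r (f x) } (ht.bijective_comp M)

end

theorem IsCoinduced.injective (ht : IsCoinduced A t) (hE : Module.Injective R E) :
    Module.Injective A W := by
  refine ⟨fun X Y _ _ _ _ f hf g => ?_⟩
  let _ := Module.compHom X (algebraMap R A)
  let _ := Module.compHom Y (algebraMap R A)
  have : IsScalarTower R A X := .of_algebraMap_smul fun _ _ => rfl
  have : IsScalarTower R A Y := .of_algebraMap_smul fun _ _ => rfl
  obtain ⟨h, hh⟩ := hE.out (f.restrictScalars R) hf (t ∘ₗ g.restrictScalars R)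
  obtain ⟨k, rfl⟩ := (ht.bijective_comp Y).2 h
  have hkf : k ∘ₗ f = g := (ht.bijective_comp X).1 (LinearMap.ext hh)
  exact ⟨k, LinearMap.congr_fun hkf⟩

theorem IsCoinduced.isCogenerator (ht : IsCoinduced A t) (hE : IsCogenerator R E) :
    IsCogenerator A W := by
  intro M _ _ m hm
  let _ := Module.compHom M (algebraMap R A)
  have : IsScalarTower R A M := .of_algebraMap_smul fun _ _ => rfl
  obtain ⟨φ, hφ⟩ := hE M m hm
  obtain ⟨f, rfl⟩ := (ht.bijective_comp M).2 φ
  refine ⟨f, fun h => hφ ?_⟩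
  rw [LinearMap.comp_apply, LinearMap.restrictScalars_apply, h, map_zero]

section

variable [IsArtinianRing R] {M : Type u} [AddCommGroup M] [Module A M] [Module R M]
  [IsScalarTower R A M] [Module.Finite R M]

variable (M) in
theorem IsCoinduced.length_hom_le (ht : IsCoinduced A t) (hE : IsMatlisModule R E) :
    Module.length R (M →ₗ[A] W) ≤ Module.length R M := by
  rw [(ht.homEquiv M).length_eq]
  exact hE.length_hom_le
    (isFiniteLength_iff_isNoetherian_isArtinian.2 ⟨inferInstance, inferInstance⟩)

variable (M) in
theorem IsCoinduced.finite_hom (ht : IsCoinduced A t) (hE : IsMatlisModule R E) :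
    Module.Finite R (M →ₗ[A] W) := by
  have hlt := (ht.length_hom_le M hE).trans_lt Module.length_ne_top.lt_top
  have := (isFiniteLength_iff_isNoetherian_isArtinian.1 (Module.length_ne_top_iff.1 hlt.ne)).1
  infer_instance

variable {B : Type u} [Ring B] [Algebra R B] [Module B W] [IsScalarTower R B W]
  [SMulCommClass A B W]

/- Evaluation `M → Hom_B(Hom_A(M, W), W)` is injective, and the length over `R` does not grow when
passing to the double dual. -/
theorem IsCoinduced.exists_eval_eq (ht : IsCoinduced A t) (ht' : IsCoinduced B t)
    (hE : IsMatlisModule R E) (φ : (M →ₗ[A] W) →ₗ[B] W) : ∃ m, ∀ f, φ f = f m := by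
  have := ht.finite_hom M hE
  have := ht'.finite_hom (M →ₗ[A] W) hE
  let ev : M →ₗ[R] (M →ₗ[A] W) →ₗ[B] W :=
    { toFun := fun m => ⟨⟨fun f => f m, fun _ _ => rfl⟩, fun _ _ => rfl⟩
      map_add' := fun x y => LinearMap.ext fun f => map_add f x y
      map_smul' := fun r x => LinearMap.ext fun f => map_smul (f.restrictScalars R) r x }
  have hinj : Function.Injective ev := by
    rw [injective_iff_map_eq_zero]
    intro x hx
    by_contra hx0
    obtain ⟨f, hf⟩ := ht.isCogenerator hE.isCogenerator M x hx0
    exact hf (LinearMap.congr_fun hx f)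
  have hrange : LinearMap.range ev = ⊤ := by
    by_contra hne
    have hlt := Submodule.length_lt hne
    rw [← (LinearEquiv.ofInjective ev hinj).length_eq] at hlt
    exact hlt.not_ge ((ht'.length_hom_le (M →ₗ[A] W) hE).trans (ht.length_hom_le M hE))
  obtain ⟨m, rfl⟩ := LinearMap.range_eq_top.1 hrange φ
  exact ⟨m, fun _ => rfl⟩

end

theorem IsCoinduced.isDualizing [IsArtinianRing R] [Module.Finite R A] {B : Type u} [Ring B]
    [Algebra R B] [Module B W] [IsScalarTower R B W] [SMulCommClass A B W] (ht : IsCoinduced A t)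
    (ht' : IsCoinduced B t) (hE : IsMatlisModule R E) : IsDualizing A B W where
  injective := ht.injective hE.injective
  isCogenerator := ht.isCogenerator hE.isCogenerator
  finite_hom M _ _ _ := by
    let _ := Module.compHom M (algebraMap R A)
    have : IsScalarTower R A M := .of_algebraMap_smul fun _ _ => rfl
    have := Module.Finite.trans (R := R) A M
    have := ht.finite_hom M hE
    exact Module.Finite.of_restrictScalars_finite R B _
  exists_eval_eq M _ _ _ := by
    let _ := Module.compHom M (algebraMap R A)
    have : IsScalarTower R A M := .of_algebraMap_smul fun _ _ => rfl
    have := Module.Finite.trans (R := R) A M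
    exact ht.exists_eval_eq ht' hE

end Coinduced

section Coregular

/-- `Hom_R(A, E)` as a bimodule over `A`, through right and left multiplication on the source: a
left module over `A` and over `Aᵐᵒᵖ`. -/
def CoregularModule (R A E : Type u) [CommRing R] [Ring A] [Algebra R A] [AddCommGroup E]
    [Module R E] : Type u :=
  A →ₗ[R] E

namespace CoregularModule

variable {R A E : Type u} [CommRing R] [Ring A] [Algebra R A] [AddCommGroup E] [Module R E]

instance : FunLike (CoregularModule R A E) A E :=
  inferInstanceAs (FunLike (A →ₗ[R] E) A E)

instance : AddCommGroup (CoregularModule R A E) :=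
  inferInstanceAs (AddCommGroup (A →ₗ[R] E))

instance : Module R (CoregularModule R A E) :=
  inferInstanceAs (Module R (A →ₗ[R] E))

instance : Module A (CoregularModule R A E) where
  smul a w := LinearMap.comp w (LinearMap.mulRight R a)
  one_smul w := LinearMap.ext fun x => congrArg w (mul_one x)
  mul_smul a b w := LinearMap.ext fun x => congrArg w (mul_assoc x a b).symm
  smul_zero _ := rfl
  smul_add _ _ _ := rfl
  add_smul a b w := LinearMap.ext fun x =>
    (congrArg w (mul_add x a b)).trans (LinearMap.map_add w _ _)
  zero_smul w := LinearMap.ext fun x =>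
    (congrArg w (mul_zero x)).trans (LinearMap.map_zero w)

instance : Module Aᵐᵒᵖ (CoregularModule R A E) where
  smul b w := LinearMap.comp w (LinearMap.mulLeft R b.unop)
  one_smul w := LinearMap.ext fun x => congrArg w (one_mul x)
  mul_smul a b w := LinearMap.ext fun x => congrArg w (mul_assoc b.unop a.unop x)
  smul_zero _ := rfl
  smul_add _ _ _ := rfl
  add_smul a b w := LinearMap.ext fun x =>
    (congrArg w (add_mul a.unop b.unop x)).trans (LinearMap.map_add w _ _)
  zero_smul w := LinearMap.ext fun x =>
    (congrArg w (zero_mul x)).trans (LinearMap.map_zero w)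

instance : SMulCommClass A Aᵐᵒᵖ (CoregularModule R A E) :=
  ⟨fun a b w => LinearMap.ext fun x => congrArg w (mul_assoc b.unop x a).symm⟩

instance : SMulCommClass Aᵐᵒᵖ A (CoregularModule R A E) :=
  .symm _ _ _

instance : IsScalarTower R A (CoregularModule R A E) :=
  ⟨fun r a w => LinearMap.ext fun x =>
    (congrArg w (mul_smul_comm r x a)).trans (LinearMap.map_smul w _ _)⟩

instance : IsScalarTower R Aᵐᵒᵖ (CoregularModule R A E) :=
  ⟨fun r a w => LinearMap.ext fun x =>
    (congrArg w (smul_mul_assoc r a.unop x)).trans (LinearMap.map_smul w _ _)⟩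

variable (R A E) in
/-- Evaluation at `1`. -/
def counit : CoregularModule R A E →ₗ[R] E :=
  LinearMap.applyₗ (R := R) (M := A) 1

theorem counit_smul (a : A) (w : CoregularModule R A E) : counit R A E (a • w) = w a :=
  congrArg w (one_mul a)

theorem counit_op_smul (b : Aᵐᵒᵖ) (w : CoregularModule R A E) :
    counit R A E (b • w) = w b.unop :=
  congrArg w (mul_one b.unop)

theorem isCoinduced_counit : IsCoinduced A (counit R A E) :=
  ⟨fun w w' h => LinearMap.ext fun a =>
      (counit_smul a w).symm.trans ((LinearMap.congr_fun h a).trans (counit_smul a w')),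
    fun φ => ⟨φ, LinearMap.ext fun a => counit_smul a φ⟩⟩

theorem isCoinduced_op_counit : IsCoinduced Aᵐᵒᵖ (counit R A E) :=
  ⟨fun w w' h => LinearMap.ext fun a => (counit_op_smul (.op a) w).symm.trans
      ((LinearMap.congr_fun h (.op a)).trans (counit_op_smul (.op a) w')),
    fun φ => ⟨φ ∘ₗ (MulOpposite.opLinearEquiv R).toLinearMap,
      LinearMap.ext fun b => counit_op_smul b (φ ∘ₗ (MulOpposite.opLinearEquiv R).toLinearMap)⟩⟩

theorem isMoritaDuality [IsArtinianRing R] [Module.Finite R A] (hE : IsMatlisModule R E) :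
    IsMoritaDuality A Aᵐᵒᵖ (CoregularModule R A E) :=
  have := Module.Finite.equiv (MulOpposite.opLinearEquiv (M := A) R)
  ⟨isCoinduced_counit.isDualizing isCoinduced_op_counit hE,
    isCoinduced_op_counit.isDualizing isCoinduced_counit hE⟩

end CoregularModule

theorem exists_isMoritaDuality (R : Type*) (A : Type u) [CommRing R] [IsArtinianRing R] [Ring A]
    [Algebra R A] [Module.Finite R A] :
    ∃ (W : Type u) (_ : AddCommGroup W) (_ : Module A W) (_ : Module Aᵐᵒᵖ W)
      (_ : SMulCommClass A Aᵐᵒᵖ W) (_ : SMulCommClass Aᵐᵒᵖ A W), IsMoritaDuality A Aᵐᵒᵖ W := by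
  -- Over the center, unlike over `R`, the Matlis module lives in the universe of `A`.
  let Z := Subalgebra.center R A
  let _ : Algebra Z A := inferInstanceAs (Algebra (Subring.center A) A)
  have : IsArtinian R Z := inferInstanceAs (IsArtinian R (Subalgebra.toSubmodule Z))
  have : IsArtinianRing Z := isArtinian_of_tower R inferInstance
  have : IsScalarTower R Z A := ⟨fun r z a => smul_mul_assoc r (z : A) a⟩
  have : Module.Finite Z A := Module.Finite.of_restrictScalars_finite R Z A
  exact ⟨_, _, _, _, _, _, CoregularModule.isMoritaDuality (isMatlisModule_envelope Z)⟩

end Coregular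

/-! ### Dual modules -/

section Dual

variable {A B W : Type u} [Ring A] [Ring B] [AddCommGroup W] [Module A W] [Module B W]
  [SMulCommClass A B W]

variable (B W) in
/-- The dual `Hom_A(M, W)` of an `A`-module `M` with respect to a bimodule `W`, as a `B`-module. -/
def dual (M : ModuleCat.{u} A) : ModuleCat.{u} B :=
  .of B (M →ₗ[A] W)

variable (B W) in
/-- The morphism `Hom_A(f, W)` between duals. -/
def dualMap {M N : ModuleCat.{u} A} (f : M ⟶ N) : dual B W N ⟶ dual B W M :=
  ModuleCat.ofHom (LinearMap.lcomp B W f.hom)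

variable (B W) in
/-- The dual of a retract. -/
def dualRetract {M N : ModuleCat.{u} A} (r : Retract M N) : Retract (dual B W M) (dual B W N) where
  i := dualMap B W r.r
  r := dualMap B W r.i
  retract := ModuleCat.hom_ext (LinearMap.ext fun (f : M →ₗ[A] W) => LinearMap.ext fun x =>
    congrArg f (LinearMap.congr_fun (congrArg ModuleCat.Hom.hom r.retract) x))

variable (B W) in
/-- The dual of a complex `X₁ → X₂ → X₃`, with terms in the opposite order. -/
def dualShortComplex (S : ShortComplex (ModuleCat.{u} A)) : ShortComplex (ModuleCat.{u} B) where
  X₁ := dual B W S.X₃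
  X₂ := dual B W S.X₂
  X₃ := dual B W S.X₁
  f := dualMap B W S.g
  g := dualMap B W S.f
  zero := ModuleCat.hom_ext (LinearMap.ext fun (f : S.X₃ →ₗ[A] W) => LinearMap.ext fun x =>
    (congrArg f (LinearMap.congr_fun (congrArg ModuleCat.Hom.hom S.zero) x)).trans (map_zero f))

theorem surjective_lcomp (hW : Module.Injective A W) {X Y : Type u} [AddCommGroup X]
    [AddCommGroup Y] [Module A X] [Module A Y] {f : X →ₗ[A] Y} (hf : Function.Injective f) :
    Function.Surjective (LinearMap.lcomp B W f) := fun g =>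
  (hW.out f hf g).imp fun _ hk => LinearMap.ext hk

theorem shortExact_dualShortComplex (hW : Module.Injective A W)
    {S : ShortComplex (ModuleCat.{u} A)} (hS : S.ShortExact) :
    (dualShortComplex B W S).ShortExact := by
  have hg : Function.Surjective S.g.hom := hS.moduleCat_surjective_g
  have := hS.epi_g
  refine ModuleCat.shortComplex_shortExact _ (fun φ => ⟨fun hφ => ?_, ?_⟩)
    (fun φ ψ h => (LinearMap.cancel_right hg).1 h) (surjective_lcomp hW hS.moduleCat_injective_f)
  · let p : S.X₂ ⟶ .of A W := ModuleCat.ofHom φ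
    have hp : S.f ≫ p = 0 := ModuleCat.hom_ext hφ
    exact ⟨(hS.exact.desc p hp).hom, congrArg ModuleCat.Hom.hom (hS.exact.g_desc p hp)⟩
  · rintro ⟨ψ, rfl⟩
    exact LinearMap.congr_fun (congrArg ModuleCat.Hom.hom (dualShortComplex B W S).zero) ψ

theorem injective_flip (hW : IsCogenerator A W) {M N : Type u} [AddCommGroup M] [Module A M]
    [AddCommGroup N] [Module B N] {f : N →ₗ[B] M →ₗ[A] W} (hf : Function.Surjective f) :
    Function.Injective f.flip := by
  rw [injective_iff_map_eq_zero]
  intro x hx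
  by_contra hx0
  obtain ⟨g, hg⟩ := hW M x hx0
  obtain ⟨y, rfl⟩ := hf g
  exact hg (LinearMap.congr_fun hx y)

end Dual

section MoritaDuality

variable {A B W : Type u} [Ring A] [Ring B] [AddCommGroup W] [Module A W] [Module B W]
  [SMulCommClass A B W] [SMulCommClass B A W]

theorem injective_dual (hW : Module.Injective B W) (P : ModuleCat.{u} A) [Projective P] :
    Injective (dual B W P) := by
  refine (Module.injective_iff_injective_object B _).1 ⟨fun X Y _ _ _ _ f hf g => ?_⟩
  have hsurj := surjective_lcomp (A := B) (B := A) (W := W) hW hf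
  obtain ⟨k, hk⟩ := Module.projective_lifting_property (LinearMap.lcomp A W f)
    (LinearMap.flip (R₂ := B) (M := X) g : P →ₗ[A] X →ₗ[B] W) hsurj
  exact ⟨k.flip, fun x => LinearMap.ext fun p => LinearMap.congr_fun (LinearMap.congr_fun hk p) x⟩

namespace IsMoritaDuality

variable (hW : IsMoritaDuality A B W)

include hW

theorem finite_dual (M : ModuleCat.{u} A) [Module.Finite A M] : Module.Finite B (dual B W M) :=
  hW.left.finite_hom M

/-- Finitely generated modules are reflexive. -/
def dualDualIso (M : ModuleCat.{u} A) [Module.Finite A M] : M ≅ dual A W (dual B W M) :=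
  LinearEquiv.toModuleIso <| LinearEquiv.ofBijective
    (LinearMap.flip LinearMap.id : M →ₗ[A] (M →ₗ[A] W) →ₗ[B] W)
    ⟨injective_flip hW.left.isCogenerator Function.surjective_id, fun φ =>
      (hW.left.exists_eval_eq M φ).imp fun _ hm => LinearMap.ext fun f => (hm f).symm⟩

theorem exists_mono_dual_pi (M : ModuleCat.{u} A) [Module.Finite A M] :
    ∃ (k : ℕ) (j : M ⟶ dual A W (.of B (Fin k → B))), Mono j := by
  have := hW.finite_dual M
  obtain ⟨k, f, hf⟩ := Module.Finite.exists_fin' B (dual B W M)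
  let j : M →ₗ[A] (Fin k → B) →ₗ[B] W := LinearMap.flip (P := W) f
  have hj : Function.Injective j := injective_flip hW.left.isCogenerator hf
  exact ⟨k, ModuleCat.ofHom j, (ModuleCat.mono_iff_injective _).2 hj⟩

theorem projective_dual (J : ModuleCat.{u} A) [Module.Finite A J] [Injective J] :
    Projective (dual B W J) := by
  obtain ⟨k, j, _⟩ := hW.exists_mono_dual_pi J
  let P : ModuleCat.{u} B := .of B (Fin k → B)
  let r : Retract J (dual A W P) := ⟨j, Injective.factorThru (𝟙 J) j, Injective.comp_factorThru _ _⟩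
  have := Projective.of_iso (hW.symm.dualDualIso P) inferInstance
  exact (dualRetract B W r).projective

theorem exists_eval_eq_of_submodule {M : Type u} [AddCommGroup M] [Module A M] [Module.Finite A M]
    (N : Submodule A M) (φ : (N →ₗ[A] W) →ₗ[B] W) : ∃ n : N, ∀ f, φ f = f n := by
  obtain ⟨m, hm⟩ := hW.left.exists_eval_eq M (φ ∘ₗ LinearMap.lcomp B W N.subtype)
  have hmN : m ∈ N := by
    by_contra hmN
    obtain ⟨f, hf⟩ := hW.left.isCogenerator _ (N.mkQ m) fun h =>
      hmN ((Submodule.Quotient.mk_eq_zero N).1 h)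
    have hres : LinearMap.lcomp B W N.subtype (f ∘ₗ N.mkQ) = 0 := LinearMap.ext fun x =>
      (congrArg f ((Submodule.Quotient.mk_eq_zero N).2 x.2)).trans (map_zero f)
    exact hf ((hm (f ∘ₗ N.mkQ)).symm.trans ((congrArg φ hres).trans (map_zero φ)))
  refine ⟨⟨m, hmN⟩, fun f => ?_⟩
  obtain ⟨g, rfl⟩ := surjective_lcomp (B := B) hW.left.injective N.injective_subtype f
  exact hm g

theorem isNoetherianRing : IsNoetherianRing A := by
  refine (isNoetherianRing_iff_ideal_fg A).2 fun N => Module.Finite.iff_fg.1 ?_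
  have : Module.Finite B (A →ₗ[A] W) := hW.left.finite_hom A
  have : Module.Finite B (N →ₗ[A] W) :=
    .of_surjective _ (surjective_lcomp hW.left.injective N.injective_subtype)
  have : Module.Finite A ((N →ₗ[A] W) →ₗ[B] W) := hW.right.finite_hom _
  let ev : N →ₗ[A] (N →ₗ[A] W) →ₗ[B] W := LinearMap.flip LinearMap.id
  exact .equiv (LinearEquiv.ofBijective ev
    ⟨injective_flip hW.left.isCogenerator Function.surjective_id, fun φ =>
      (hW.exists_eval_eq_of_submodule N φ).imp fun _ hn =>
        LinearMap.ext fun f => (hn f).symm⟩).symm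

theorem finite_of_isInjectiveEnvelope {M E : ModuleCat.{u} A} [Module.Finite A M] {f : M ⟶ E}
    (hf : IsInjectiveEnvelope f) : Module.Finite A E := by
  have := hW.isNoetherianRing
  obtain ⟨k, j, _⟩ := hW.exists_mono_dual_pi M
  have := injective_dual hW.left.injective (ModuleCat.of B (Fin k → B))
  have := hf.mono
  have : Mono (f ≫ Injective.factorThru j f) := by rwa [Injective.comp_factorThru]
  have hg := hf.mono_of_comp (Injective.factorThru j f)
  have := hW.symm.finite_dual (.of B (Fin k → B))
  exact Module.Finite.of_injective _ ((ModuleCat.mono_iff_injective _).1 hg)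

theorem finite_cosyzygy (M : ModuleCat.{u} A) [Module.Finite A M] :
    ∀ i, Module.Finite A (cosyzygy M i)
  | 0 => inferInstanceAs (Module.Finite A M)
  | i + 1 =>
    have := finite_cosyzygy M i
    have := hW.finite_of_isInjectiveEnvelope (isInjectiveEnvelope_envelopeι (cosyzygy M i))
    .of_surjective _ (Submodule.mkQ_surjective (LinearMap.range (envelopeι (cosyzygy M i)).hom))

theorem finite_minInj (M : ModuleCat.{u} A) [Module.Finite A M] (i : ℕ) :
    Module.Finite A (minInj M i) :=
  have := hW.finite_cosyzygy M i
  hW.finite_of_isInjectiveEnvelope (isInjectiveEnvelope_envelopeι (cosyzygy M i))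

theorem hasCosyzygies :
    HasCosyzygies (ModuleCat.isFG A) (ModuleCat.isFG A ⊓ isInjective (ModuleCat.{u} A)) :=
  fun M hM =>
    have : Module.Finite A M := hM
    ⟨cosyzygyShortComplex M 0, shortExact_cosyzygyShortComplex M 0, rfl,
      ⟨hW.finite_minInj M 0, injective_minInj M 0⟩, hW.finite_cosyzygy M 1⟩

theorem hasSyzygies :
    HasSyzygies (ModuleCat.isFG A) (ModuleCat.isFG A ⊓ isProjective (ModuleCat.{u} A)) := by
  intro M hM
  have := hW.isNoetherianRing
  have : Module.Finite A M := hM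
  obtain ⟨k, f, hf⟩ := Module.Finite.exists_fin' A M
  exact ⟨f.shortComplexKer, LinearMap.shortExact_shortComplexKer hf,
    inferInstanceAs (Module.Finite A (LinearMap.ker f)),
    ⟨inferInstanceAs (Module.Finite A (Fin k → A)),
      inferInstanceAs (Projective (ModuleCat.of A (Fin k → A)))⟩, rfl⟩

end IsMoritaDuality

end MoritaDuality

section DualDimension

variable {A B W : Type u} [Ring A] [Ring B] [AddCommGroup W] [Module A W] [Module B W]
  [SMulCommClass A B W] [SMulCommClass B A W]

theorem hasInjectiveDimensionLT_dual (hA : Module.Injective A W) (hB : Module.Injective B W) {d : ℕ}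
    (X : ModuleCat.{u} A) (hX : HasProjectiveDimensionLT X (d + 1)) :
    HasInjectiveDimensionLT (dual B W X) (d + 1) := by
  induction d generalizing X with
  | zero =>
    have := projective_iff_hasProjectiveDimensionLT_one.2 hX
    exact injective_iff_hasInjectiveDimensionLT_one.1 (injective_dual hB X)
  | succ d ih =>
    have hS := ModuleCat.shortExact_projectiveShortComplex X
    have hK := ih _ ((hS.hasProjectiveDimensionLT_X₃_iff d inferInstance).1 hX)
    have := injective_dual hB X.projectiveShortComplex.X₂
    exact (shortExact_dualShortComplex hA hS).hasInjectiveDimensionLT_X₁ (d + 1) hK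
      (hasInjectiveDimensionLT_of_ge (dual B W X.projectiveShortComplex.X₂) 1 _ (by omega))

theorem IsMoritaDuality.hasProjectiveDimensionLT_dual (hW : IsMoritaDuality A B W) {d : ℕ}
    (X : ModuleCat.{u} A) [Module.Finite A X] (hX : HasInjectiveDimensionLT X (d + 1)) :
    HasProjectiveDimensionLT (dual B W X) (d + 1) := by
  induction d generalizing X with
  | zero =>
    have := injective_iff_hasInjectiveDimensionLT_one.2 hX
    exact projective_iff_hasProjectiveDimensionLT_one.1 (hW.projective_dual X)
  | succ d ih =>
    obtain ⟨S, hS, rfl, ⟨hQ, hQ'⟩, hC⟩ := hW.hasCosyzygies X ‹_›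
    have : Module.Finite A S.X₂ := hQ
    have : Module.Finite A S.X₃ := hC
    have : Injective S.X₂ := hQ'
    have hDC := ih S.X₃ (hS.hasInjectiveDimensionLT_X₃ (d + 1)
      (hasInjectiveDimensionLT_of_ge S.X₂ 1 _ (by omega)) hX)
    have := hW.projective_dual S.X₂
    exact (shortExact_dualShortComplex hW.left.injective hS).hasProjectiveDimensionLT_X₃ (d + 1) hDC
      (hasProjectiveDimensionLT_of_ge (dual B W S.X₂) 1 _ (by omega))

theorem IsMoritaDuality.hasProjectiveDimensionLT_of_glDim_le (hW : IsMoritaDuality A B W) {n : ℕ}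
    (hA : glDim A ≤ (n : WithBot ℕ∞)) (Y : ModuleCat.{u} B) [Module.Finite B Y] :
    HasProjectiveDimensionLT Y (n + 1) := by
  have := hW.symm.finite_dual Y
  have := hW.hasProjectiveDimensionLT_dual (dual A W Y) (hasInjectiveDimensionLT_of_glDim_le hA _)
  exact hasProjectiveDimensionLT_of_iso (hW.symm.dualDualIso Y).symm (n + 1)

end DualDimension

/-! ### Orthogonality of injective and projective modules -/

section Orthogonality

/-- `Extⁱ_A(J, P) = 0` for `1 ≤ i ≤ m`, all finitely generated injective modules `J` and all
finitely generated projective modules `P`: the orthogonality that a maximal `m`-orthogonal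
subcategory forces on the modules it has to contain. -/
def InjectivesOrthogonalProjectives (m : ℕ) (A : Type u) [Ring A] : Prop :=
  ∀ J : ModuleCat.{u} A, (ModuleCat.isFG A ⊓ isInjective _) J →
    ∀ P : ModuleCat.{u} A, (ModuleCat.isFG A ⊓ isProjective _) P →
      ∀ i : ℕ, 1 ≤ i → i ≤ m → Subsingleton (Abelian.Ext J P i)

theorem IsMaximalOrthogonal.injectivesOrthogonalProjectives {A : Type u} [Ring A] {m : ℕ}
    {𝒞 : ObjectProperty (ModuleCat.{u} A)} (h𝒞 : IsMaximalOrthogonal m 𝒞 (ModuleCat.isFG A)) :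
    InjectivesOrthogonalProjectives m A := by
  rintro J ⟨hJ, hJ'⟩ P ⟨hP, hP'⟩ i hi him
  have : Injective J := hJ'
  have : Projective P := hP'
  have hJ𝒞 : 𝒞 J := by
    rw [h𝒞.eq_right]
    exact ⟨⟨hJ, fun C _ i hi _ => HasInjectiveDimensionLT.subsingleton J 1 i hi C⟩, hJ⟩
  have hP𝒞 : 𝒞 P := by
    rw [h𝒞.eq_left]
    exact ⟨⟨hP, fun C _ i hi _ => HasProjectiveDimensionLT.subsingleton P 1 i hi C⟩, hP⟩
  rw [h𝒞.eq_left] at hJ𝒞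
  exact hJ𝒞.1.2 P hP𝒞 i hi him

variable {A B W : Type u} [Ring A] [Ring B] [AddCommGroup W] [Module A W] [Module B W]
  [SMulCommClass A B W] [SMulCommClass B A W] {m : ℕ}

theorem InjectivesOrthogonalProjectives.projective (h : InjectivesOrthogonalProjectives m A)
    (hW : IsMoritaDuality A B W) (J : ModuleCat.{u} A) [Module.Finite A J] [Injective J]
    (hJ : HasProjectiveDimensionLT J (m + 1)) : Projective J := by
  obtain ⟨Q, ⟨_, hQ⟩, ⟨r⟩⟩ := hW.hasSyzygies.exists_retract hJ (h J ⟨‹_›, ‹_›⟩) ‹_›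
  have : Projective Q := hQ
  exact r.projective

theorem InjectivesOrthogonalProjectives.injective (h : InjectivesOrthogonalProjectives m A)
    (hW : IsMoritaDuality A B W) (P : ModuleCat.{u} A) [Module.Finite A P] [Projective P]
    (hP : HasInjectiveDimensionLT P (m + 1)) : Injective P := by
  obtain ⟨J, ⟨_, hJ⟩, ⟨r⟩⟩ := hW.hasCosyzygies.exists_retract hP
    (fun J hJ => h J hJ P ⟨‹_›, ‹_›⟩) ‹_›
  have : Injective J := hJ
  exact r.injective

theorem InjectivesOrthogonalProjectives.projective_of_isMoritaDuality
    (h : InjectivesOrthogonalProjectives m A) (hW : IsMoritaDuality A B W) (J : ModuleCat.{u} B)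
    [Module.Finite B J] [Injective J] (hJ : HasProjectiveDimensionLT J (m + 1)) :
    Projective J := by
  have := hW.symm.finite_dual J
  have := hW.symm.projective_dual J
  have := h.injective hW (dual A W J)
    (hasInjectiveDimensionLT_dual hW.right.injective hW.left.injective J hJ)
  exact Projective.of_iso (hW.symm.dualDualIso J).symm (hW.projective_dual (dual A W J))

end Orthogonality

/-! ### Symmetry of the dominant dimension -/

section Symmetry

theorem exists_epi_of_forall_exists_factorThru {A : Type u} [Ring A]
    {𝒬 : ObjectProperty (ModuleCat.{u} A)}
    (h𝒬 : ∀ (r : ℕ) (Q : Fin r → ModuleCat.{u} A), (∀ j, 𝒬 (Q j)) → 𝒬 (.of A (∀ j, Q j)))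
    {K : ModuleCat.{u} A} [Module.Finite A K]
    (hK : ∀ q : regular A ⟶ K, ∃ (Q : _) (_ : 𝒬 Q) (f : regular A ⟶ Q) (p : Q ⟶ K), f ≫ p = q) :
    ∃ (Q : _) (_ : 𝒬 Q) (p : Q ⟶ K), Epi p := by
  obtain ⟨r, x, hx⟩ := Module.Finite.exists_fin (R := A) (M := K)
  choose Q hQ f p hfp using fun j => hK (ModuleCat.ofHom (LinearMap.toSpanSingleton A K (x j)))
  let q : (∀ j, Q j) →ₗ[A] K := LinearMap.lsum A (fun j => Q j) ℕ fun j => (p j).hom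
  refine ⟨.of A (∀ j, Q j), h𝒬 r Q hQ, ModuleCat.ofHom q, ?_⟩
  rw [ModuleCat.epi_iff_range_eq_top, eq_top_iff, ← hx, Submodule.span_le]
  rintro _ ⟨j, rfl⟩
  have hfx : (p j).hom ((f j).hom (1 : A)) = x j :=
    (LinearMap.congr_fun (congrArg ModuleCat.Hom.hom (hfp j)) (1 : A)).trans (one_smul A (x j))
  exact ⟨Pi.single j ((f j).hom (1 : A)), (LinearMap.lsum_piSingle ..).trans hfx⟩

/-- The finitely generated projective-injective modules. -/
abbrev projInj (A : Type u) [Ring A] : ObjectProperty (ModuleCat.{u} A) :=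
  ModuleCat.isFG A ⊓ (isProjective _ ⊓ isInjective _)

theorem projInj_pi {A : Type u} [Ring A] (r : ℕ) (Q : Fin r → ModuleCat.{u} A)
    (hQ : ∀ j, projInj A (Q j)) : projInj A (.of A (∀ j, Q j)) := by
  have (j : Fin r) : Module.Finite A (Q j) := (hQ j).1
  have (j : Fin r) : Projective (Q j) := (hQ j).2.1
  have (j : Fin r) : Module.Injective A (Q j) :=
    (Module.injective_iff_injective_object A (Q j)).2 (hQ j).2.2
  have : Module.Projective A (∀ j, Q j) := .of_equiv DFinsupp.linearEquivFunOnFintype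
  exact ⟨inferInstanceAs (Module.Finite A (∀ j, Q j)),
    inferInstanceAs (Projective (ModuleCat.of A (∀ j, Q j))),
    (Module.injective_iff_injective_object A _).1 inferInstance⟩

namespace IsMoritaDuality

variable {A B W : Type u} [Ring A] [Ring B] [AddCommGroup W] [Module A W] [Module B W]
  [SMulCommClass A B W] [SMulCommClass B A W] (hW : IsMoritaDuality A B W) {n : ℕ}

include hW

theorem projInj_dual {Q : ModuleCat.{u} A} (hQ : projInj A Q) : projInj B (dual B W Q) :=
  have : Module.Finite A Q := hQ.1
  have : Projective Q := hQ.2.1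
  have : Injective Q := hQ.2.2
  ⟨hW.finite_dual Q, hW.projective_dual Q, injective_dual hW.right.injective Q⟩

/- A coresolution of `A` by projective-injective modules of length greater than the injective
dimension of `K` gives a projective-injective cover of `K`, and the injective dimension of its
kernel is larger by at most one; dualizing the kernels builds the coresolution of `dual B W K`. -/
theorem hasCoresolution_dual (hA : HasCoresolution (projInj A) n (regular A)) {k i : ℕ}
    (hki : i + k ≤ n) (K : ModuleCat.{u} A) [Module.Finite A K]
    (hK : HasInjectiveDimensionLT K (i + 1)) : HasCoresolution (projInj B) k (dual B W K) := by
  induction k generalizing i K with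
  | zero => exact .zero _
  | succ k ih =>
    obtain ⟨n, rfl⟩ : ∃ n', n = n' + 1 := ⟨n - 1, by omega⟩
    obtain ⟨Q, hQ, p, hp⟩ := exists_epi_of_forall_exists_factorThru projInj_pi (K := K)
      (hA.exists_factorThru (fun Q hQ => hQ.2.1)
        (hasInjectiveDimensionLT_of_ge K (i + 1) _ (by omega)))
    have hS := LinearMap.shortExact_shortComplexKer ((ModuleCat.epi_iff_surjective p).1 hp)
    have := hW.isNoetherianRing
    have : Module.Finite A Q := hQ.1
    have : Injective Q := hQ.2.2
    have hN := hS.hasInjectiveDimensionLT_X₁ (i + 1) hK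
      (hasInjectiveDimensionLT_of_ge Q 1 _ (by omega))
    exact .succ (shortExact_dualShortComplex hW.left.injective hS) (hW.projInj_dual hQ)
      (ih (i := i + 1) (by omega) (.of A (LinearMap.ker p.hom)) hN)

theorem hasDominantDimensionGE (h : HasDominantDimensionGE n A) : HasDominantDimensionGE n B := by
  have hA : HasCoresolution (projInj A) n (regular A) :=
    hasCoresolution_of_minInj _ fun i hi => ⟨hW.finite_minInj _ i, h i hi, injective_minInj _ i⟩
  have := hW.symm.finite_dual (regular B)
  have := injective_dual hW.left.injective (regular B)
  have hDD := hW.hasCoresolution_dual hA (i := 0) (k := n) (by omega) (dual A W (regular B))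
    (injective_iff_hasInjectiveDimensionLT_one.1 this)
  exact fun i hi => projective_minInj_of_hasCoresolution (fun Q hQ => hQ.2) hDD
    (.ofIso (hW.symm.dualDualIso (regular B))) hi

end IsMoritaDuality

end Symmetry

end

end HigherAuslander

theorem proposition3p3_general {A B W : Type u} [Ring A] [Ring B] [AddCommGroup W] [Module A W]
    [Module B W] [SMulCommClass A B W] [SMulCommClass B A W]
    (hW : HigherAuslander.IsMoritaDuality A B W) (n : ℕ) (hn : 2 ≤ n)
    (hA : HigherAuslander.glDim A ≤ (n : WithBot ℕ∞))
    (hExt : HigherAuslander.InjectivesOrthogonalProjectives (n - 1) A) :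
    List.TFAE [
      HigherAuslander.IsAuslanderAlgebra (n - 1) A,
      projectiveDimension (HigherAuslander.sumMinInj (n - 1) A) ≤ ((n - 1 : ℕ) : WithBot ℕ∞),
      projectiveDimension (HigherAuslander.sumMinInj (n - 1) B) ≤
        ((n - 1 : ℕ) : WithBot ℕ∞)] := by
  open HigherAuslander in
  obtain ⟨m, rfl⟩ : ∃ m, n = m + 1 := ⟨n - 1, by omega⟩
  simp only [Nat.add_sub_cancel] at hExt ⊢
  have hm : 1 ≤ m := by omega
  have hAus : IsAuslanderAlgebra m A ↔ HasDominantDimensionGE (m + 1) A :=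
    ⟨fun h i hi => h.projective i (Nat.le_of_lt_succ hi),
      fun h => ⟨hA, fun i hi => h i (Nat.lt_succ_of_le hi)⟩⟩
  tfae_have 1 → 2 := fun h => (hAus.1 h).projectiveDimension_sumMinInj_le
  tfae_have 2 → 1 := fun h => hAus.2 <|
    hasDominantDimensionGE_of_projectiveDimension_sumMinInj_le hm
      (hasProjectiveDimensionLT_of_glDim_le hA _)
      (fun i hi => have := hW.finite_minInj (regular A) i; hExt.projective hW _ hi) h
  tfae_have 1 → 3 := fun h =>
    (hW.hasDominantDimensionGE (hAus.1 h)).projectiveDimension_sumMinInj_le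
  tfae_have 3 → 1 := fun h => hAus.2 <| hW.symm.hasDominantDimensionGE <|
    have := hW.symm.finite_cosyzygy (regular B) (m + 1)
    hasDominantDimensionGE_of_projectiveDimension_sumMinInj_le hm
      (hW.hasProjectiveDimensionLT_of_glDim_le hA _)
      (fun i hi =>
        have := hW.symm.finite_minInj (regular B) i
        hExt.projective_of_isMoritaDuality hW _ hi) h
  tfae_finish

theorem proposition3p3 {R : Type*} [CommRing R] [IsArtinianRing R]
    (Λ : Type u) [Ring Λ] [Algebra R Λ] [Module.Finite R Λ]
    (n : ℕ) (hn : 2 ≤ n) (hgl : HigherAuslander.glDim Λ = (n : WithBot ℕ∞))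
    (hmax : ∃ 𝒞 : ObjectProperty (ModuleCat.{u} Λ),
      HigherAuslander.IsMaximalOrthogonal (n - 1) 𝒞 (ModuleCat.isFG Λ)) :
    List.TFAE [
      HigherAuslander.IsAuslanderAlgebra (n - 1) Λ,
      projectiveDimension (HigherAuslander.sumMinInj (n - 1) Λ) ≤ ((n - 1 : ℕ) : WithBot ℕ∞),
      projectiveDimension (HigherAuslander.sumMinInj (n - 1) Λᵐᵒᵖ) ≤
        ((n - 1 : ℕ) : WithBot ℕ∞)] := by
  obtain ⟨W, _, _, _, _, _, hW⟩ := HigherAuslander.exists_isMoritaDuality R Λ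
  exact proposition3p3_general hW n hn hgl.le hmax.choose_spec.injectivesOrthogonalProjectives
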